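/- Let $G$ be a finite connected graph, in which loops and multiple edges are allowed, and choose a direction $\vec\sigma$ for every edge $\sigma$ of $G$. Let $C_0(G;\mathbb{Z})$ and $C_1(G;\mathbb{Z})$ be the free abelian groups on the vertices and on the directed edges, let $\partial : C_1(G;\mathbb{Z}) \to C_0(G;\mathbb{Z})$ be the boundary map sending a directed edge to its end point minus its starting point, and let $Z_1(G;\mathbb{Z}) = \ker \partial$. Let $C^i(G;\mathbb{Z}) = \mathrm{Hom}(C_i(G;\mathbb{Z}),\mathbb{Z})$, let $B^1(G;\mathbb{Z}) \subset C^1(G;\mathbb{Z})$ be the image of the coboundary map $C^0(G;\mathbb{Z}) \to C^1(G;\mathbb{Z})$, $f \mapsto f \circ \partial$, and let $\Pi : C^1(G;\mathbb{Z}) \to C_1(G;\mathbb{Z})$ be the isomorphism $F \mapsto \sum_{\sigma \in E(G)} F(\vec\sigma)\, \vec\sigma$. Then the sum of $Z_1(G;\mathbb{Z})$ and $\Pi(B^1(G;\mathbb{Z}))$ in $C_1(G;\mathbb{Z})$ is direct, the inclusion $$Z_1(G;\mathbb{Z}) \oplus \Pi(B^1(G;\mathbb{Z})) \subset C_1(G;\mathbb{Z})$$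 is a rational equivalence (it becomes an isomorphism after tensoring with $\mathbb{Q}$), and the quotient $$U = C_1(G;\mathbb{Z}) \,/\, [\,Z_1(G;\mathbb{Z}) \oplus \Pi(B^1(G;\mathbb{Z}))\,]$$ is a finite abelian group whose order $|U|$ is the number of spanning trees of $G$, that is, of subgraphs of $G$ that contain all vertices of $G$ and are trees (connected, without loops, and with a unique simple path, as a sequence of vertices and edges, between any two distinct vertices). -/

import Mathlib

namespace Graph

variable {α β : Type*}

/-- `G.IsWalk x w y`: the list `w` of (edge, next vertex) pairs is a walk from `x` to `y` in the
multigraph `G`. Edges are recorded, so that parallel edges give different walks. -/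
def IsWalk (G : Graph α β) : α → List (β × α) → α → Prop
  | x, [], y => x ∈ G.vertexSet ∧ x = y
  | x, p :: w, y => G.IsLink p.1 x p.2 ∧ IsWalk G p.2 w y

/-- A simple path: a walk whose successive vertices are all distinct. -/
def IsSimplePath (G : Graph α β) (x : α) (w : List (β × α)) (y : α) : Prop :=
  G.IsWalk x w y ∧ (x :: w.map Prod.snd).Nodup

/-- Any two distinct vertices are joined by a simple path. -/
def IsConnected (G : Graph α β) : Prop :=
  ∀ x ∈ G.vertexSet, ∀ y ∈ G.vertexSet, x ≠ y → ∃ w, G.IsSimplePath x w y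

/-- A tree: a connected multigraph without loops in which any two distinct vertices are joined by
a unique simple path. (A simple path never uses a loop, so loops are excluded explicitly; parallel
edges are excluded by uniqueness.) -/
structure IsTree (G : Graph α β) : Prop where
  connected : G.IsConnected
  loopless : ∀ e x, ¬ G.IsLoopAt e x
  unique_path : ∀ x ∈ G.vertexSet, ∀ y ∈ G.vertexSet, x ≠ y → ∃! w, G.IsSimplePath x w y

/-- The spanning trees of `G`: the subgraphs on all vertices of `G` that are trees. -/
def spanningTrees (G : Graph α β) : Set (Graph α β) :=
  {T | T ≤s G ∧ T.IsTree}

/-- A choice of a direction for every edge of `G`, from `src e` to `tgt e`. -/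
structure EdgeDirection (G : Graph α β) where
  src : G.edgeSet → G.vertexSet
  tgt : G.edgeSet → G.vertexSet
  isLink : ∀ e : G.edgeSet, G.IsLink e (src e) (tgt e)

/-- Integral chains `C₀(G;ℤ)`, the free abelian group on the vertices. -/
abbrev C0 (G : Graph α β) : Type _ := G.vertexSet →₀ ℤ

/-- Integral chains `C₁(G;ℤ)`, the free abelian group on the edges; once directions are chosen,
`Finsupp.single e 1` stands for the edge `e` with its chosen direction. -/
abbrev C1 (G : Graph α β) : Type _ := G.edgeSet →₀ ℤ

/-- The isomorphism `Π : C¹(G;ℤ) = Hom(C₁(G;ℤ), ℤ) → C₁(G;ℤ)`, `F ↦ ∑ₑ F(e) · e`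
(see `Pi_apply`). -/
noncomputable def Pi (G : Graph α β) [Finite G.edgeSet] : Module.Dual ℤ G.C1 ≃ₗ[ℤ] G.C1 :=
  (Finsupp.llift ℤ ℤ ℤ G.edgeSet).symm ≪≫ₗ (Finsupp.linearEquivFunOnFinite ℤ ℤ G.edgeSet).symm

theorem Pi_apply (G : Graph α β) [Fintype G.edgeSet] (F : Module.Dual ℤ G.C1) :
    G.Pi F = ∑ e, F (Finsupp.single e 1) • Finsupp.single e 1 := by
  classical
  ext e
  simp [Pi, Finsupp.finsetSum_apply, Finsupp.single_apply]

namespace EdgeDirection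

variable {G : Graph α β}

/-- The boundary map `∂ : C₁(G;ℤ) → C₀(G;ℤ)`, sending a directed edge to its end minus its
start. -/
noncomputable def boundary (d : G.EdgeDirection) : G.C1 →ₗ[ℤ] G.C0 :=
  Finsupp.linearCombination ℤ
    (fun e => Finsupp.single (d.tgt e) (1 : ℤ) - Finsupp.single (d.src e) 1)

/-- The coboundary map `C⁰(G;ℤ) = Hom(C₀, ℤ) → C¹(G;ℤ) = Hom(C₁, ℤ)`, `f ↦ f ∘ ∂`. -/
noncomputable def coboundary (d : G.EdgeDirection) :
    Module.Dual ℤ G.C0 →ₗ[ℤ] Module.Dual ℤ G.C1 :=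
  d.boundary.dualMap

/-- The integral 1-cycles `Z₁(G;ℤ) = ker ∂`. -/
noncomputable def Z1 (d : G.EdgeDirection) : Submodule ℤ G.C1 :=
  LinearMap.ker d.boundary

/-- The integral 1-coboundaries `B¹(G;ℤ)`, the image of the coboundary map. -/
noncomputable def B1 (d : G.EdgeDirection) : Submodule ℤ (Module.Dual ℤ G.C1) :=
  LinearMap.range d.coboundary

/-- `Π(B¹(G;ℤ))`, as a sublattice of `C₁(G;ℤ)`. -/
noncomputable def PiB1 (d : G.EdgeDirection) [Finite G.edgeSet] : Submodule ℤ G.C1 :=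
  d.B1.map G.Pi.toLinearMap

end EdgeDirection

end Graph

/-! Fix a root `r` and forget the coefficient of the boundary at `r`. The resulting map from `C1` to
ℤ^(V∖r) is onto because `G` is connected, has kernel `Z1`, and carries `PiB1` onto the range of the
reduced Laplacian L (`map_PiB1`). Hence U is the cokernel of L, of order |det L|. `Z1` and `PiB1`
are orthogonal for the standard positive definite form; this gives the direct sum and also det L ≠
0, so U is finite and the inclusion is a rational equivalence.

The matrix-tree theorem is proved by expanding det L in its rows: row v is a sum over edges, so a
term is a choice of an edge f(v) for each v ≠ r. It vanishes unless every f(v) is a non-loop edge at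
v. Otherwise it is det(1 - N), with N(v) the other end of f(v), and equals 1 if iterating N always
reaches `r` and 0 if not (`Matrix.det_one_sub_parent`). The surviving choices are the spanning trees
with edges pointing towards `r` (`ncard_parentMaps`). -/

namespace Graph

variable {α β : Type*} {G T : Graph α β} {x y z r : α} {e : β} {w w' : List (β × α)}

/-! ### Walks and simple paths -/

theorem IsWalk.left_mem (h : G.IsWalk x w y) : x ∈ G.vertexSet := by
  cases w with
  | nil => exact h.1
  | cons p w => exact h.1.left_mem

theorem IsWalk.end_mem_support (h : G.IsWalk x w y) : y ∈ x :: w.map Prod.snd := by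
  induction w generalizing x with
  | nil => simp [h.2]
  | cons p w ih => exact List.mem_cons_of_mem _ (ih h.2)

theorem IsWalk.append (h : G.IsWalk x w y) (h' : G.IsWalk y w' z) : G.IsWalk x (w ++ w') z := by
  induction w generalizing x with
  | nil => obtain ⟨-, rfl⟩ := h; exact h'
  | cons p w ih => exact ⟨h.1, ih h.2⟩

theorem IsWalk.exists_suffix (h : G.IsWalk x w y) (hz : z ∈ x :: w.map Prod.snd) :
    ∃ w', G.IsWalk z w' y ∧ z :: w'.map Prod.snd <:+ x :: w.map Prod.snd := by
  induction w generalizing x with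
  | nil =>
    obtain rfl : z = x := by simpa using hz
    exact ⟨[], h, List.suffix_rfl⟩
  | cons p w ih =>
    rcases List.mem_cons.1 hz with rfl | hz
    · exact ⟨_, h, List.suffix_rfl⟩
    · obtain ⟨w', h1, h2⟩ := ih h.2 hz
      exact ⟨w', h1, h2.trans (List.suffix_cons _ _)⟩

theorem IsSimplePath.tail {p : β × α} (h : G.IsSimplePath x (p :: w) y) :
    G.IsSimplePath p.2 w y :=
  ⟨h.1.2, (List.nodup_cons.1 h.2).2⟩

theorem IsSimplePath.cons (h : G.IsSimplePath y w z) (hl : G.IsLink e x y)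
    (hx : x ∉ y :: w.map Prod.snd) : G.IsSimplePath x ((e, y) :: w) z :=
  ⟨⟨hl, h.1⟩, List.nodup_cons.2 ⟨hx, h.2⟩⟩

/-- A simple path restarted at one of its vertices other than the first one avoids the first one. -/
theorem IsSimplePath.exists_suffix (h : G.IsSimplePath x w y) (hz : z ∈ x :: w.map Prod.snd) :
    ∃ w', G.IsSimplePath z w' y ∧ (z ≠ x → x ∉ z :: w'.map Prod.snd) := by
  obtain ⟨w', h1, h2⟩ := h.1.exists_suffix hz
  refine ⟨w', ⟨h1, h.2.sublist h2.sublist⟩, fun hne hx => ?_⟩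
  rcases List.suffix_cons_iff.1 h2 with h3 | h3
  · exact hne (List.cons.inj h3).1
  · exact (List.nodup_cons.1 h.2).1 (h3.subset hx)

theorem IsWalk.exists_isSimplePath (h : G.IsWalk x w y) : ∃ w', G.IsSimplePath x w' y := by
  induction w generalizing x with
  | nil => exact ⟨[], h, by simp⟩
  | cons p w ih =>
    obtain ⟨w', h'⟩ := ih h.2
    by_cases hx : x ∈ p.2 :: w'.map Prod.snd
    · obtain ⟨w'', h'', -⟩ := h'.exists_suffix hx
      exact ⟨w'', h''⟩
    · exact ⟨_, h'.cons h.1 hx⟩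

/-! ### Trees as parent relations -/

/-- `P v e u` says that the first edge on the way from `v` to the root `r` is `e`, and that it
leads to `u`; the edges of `T` are exactly the edges which arise in this way, and `depth`
decreases on the way to the root. -/
structure IsParentRel (T : Graph α β) (r : α) (P : α → β → α → Prop) (depth : α → ℕ) : Prop where
  root_mem : r ∈ T.vertexSet
  not_root : ∀ {e u}, ¬ P r e u
  exists_parent : ∀ v ∈ T.vertexSet, v ≠ r → ∃ e u, P v e u
  unique : ∀ {v e u e' u'}, P v e u → P v e' u' → e = e' ∧ u = u'
  isLink_iff : ∀ {e x y}, T.IsLink e x y ↔ P x e y ∨ P y e x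
  depth_lt : ∀ {v e u}, P v e u → depth u < depth v

namespace IsParentRel

variable {P : α → β → α → Prop} {depth : α → ℕ}

/-- `Descends P y x`: the vertex `x` lies on the way from `y` to the root. -/
def Descends (P : α → β → α → Prop) : α → α → Prop :=
  Relation.ReflTransGen fun a b => ∃ e, P a e b

theorem depth_le (h : IsParentRel T r P depth) (hd : Descends P y x) : depth x ≤ depth y := by
  induction hd with
  | refl => rfl
  | tail _ h' ih => obtain ⟨e, h'⟩ := h'; exact (h.depth_lt h').le.trans ih

theorem parent_descends (h : IsParentRel T r P depth) (hd : Descends P y x) (hne : y ≠ x)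
    (hp : P y e z) : Descends P z x := by
  rcases Relation.ReflTransGen.cases_head hd with rfl | ⟨c, ⟨e', hc⟩, hcx⟩
  · exact absurd rfl hne
  · rwa [(h.unique hp hc).2]

/-- A walk can enter or leave the subtree below `x` only through `x` itself. -/
theorem descends_of_avoid (h : IsParentRel T r P depth) (hw : T.IsWalk z w y)
    (hx : x ∉ z :: w.map Prod.snd) (hd : Descends P y x) : Descends P z x := by
  induction w generalizing z with
  | nil => rwa [hw.2]
  | cons p w ih =>
    have hd' := ih hw.2 (fun h' => hx (List.mem_cons_of_mem _ h'))
    rcases h.isLink_iff.1 hw.1 with h' | h'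
    · exact Relation.ReflTransGen.head ⟨_, h'⟩ hd'
    · exact h.parent_descends hd' (by rintro rfl; simp at hx) h'

/-- The only edge leaving the subtree below the child `c` leads to `x`, which the walk avoids. -/
theorem end_descends (h : IsParentRel T r P depth) {c : α} (hc : P c e x) (hw : T.IsWalk z w y)
    (hx : x ∉ z :: w.map Prod.snd) (hd : Descends P z c) : Descends P y c := by
  induction w generalizing z with
  | nil => rwa [← hw.2]
  | cons p w ih =>
    refine ih hw.2 (fun h' => hx (List.mem_cons_of_mem _ h')) ?_
    rcases h.isLink_iff.1 hw.1 with h' | h'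
    · refine h.parent_descends hd ?_ h'
      rintro rfl
      have := (h.unique hc h').2
      simp [this] at hx
    · exact Relation.ReflTransGen.head ⟨_, h'⟩ hd

/-- A simple path from `x` to `y` starts towards the root if `y` is not a descendant of `x`, and
towards the child of `x` above `y` otherwise. -/
theorem first_step (h : IsParentRel T r P depth) {p : β × α} (hw : T.IsSimplePath x (p :: w) y) :
    (P x p.1 p.2 ∧ ¬ Descends P y x) ∨
      (P p.2 p.1 x ∧ Descends P y p.2 ∧ Descends P y x) := by
  have hx := (List.nodup_cons.1 hw.2).1
  rcases h.isLink_iff.1 hw.1.1 with h' | h'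
  · exact .inl ⟨h', fun hd => (h.depth_lt h').not_ge
      (h.depth_le (h.descends_of_avoid hw.1.2 hx hd))⟩
  · have := h.end_descends h' hw.1.2 hx .refl
    exact .inr ⟨h', this, this.tail ⟨_, h'⟩⟩

theorem eq_of_child (h : IsParentRel T r P depth) {c c' : α} {e' : β} (hc : P c e x)
    (hc' : P c' e' x) (hd : Descends P c c') : c = c' := by
  by_contra hne
  exact (h.depth_lt hc').not_ge (h.depth_le (h.parent_descends hd hne hc))

theorem path_unique (h : IsParentRel T r P depth) (hw : T.IsSimplePath x w y)
    (hw' : T.IsSimplePath x w' y) : w = w' := by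
  induction w generalizing x w' with
  | nil =>
    cases w' with
    | nil => rfl
    | cons p w' =>
      have := hw'.1.2.end_mem_support
      rw [← hw.1.2] at this
      exact absurd this (List.nodup_cons.1 hw'.2).1
  | cons p w ih =>
    cases w' with
    | nil =>
      have := hw.1.2.end_mem_support
      rw [← hw'.1.2] at this
      exact absurd this (List.nodup_cons.1 hw.2).1
    | cons q w' =>
      have hpq : p = q := by
        rcases h.first_step hw with ⟨h1, h2⟩ | ⟨h1, h2, h3⟩ <;>
          rcases h.first_step hw' with ⟨h1', h2'⟩ | ⟨h1', h2', h3'⟩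
        · exact Prod.ext_iff.2 (h.unique h1 h1')
        · exact absurd h3' h2
        · exact absurd h3 h2'
        -- Both children of `x` lie on the unique way from `y` to the root, so one descends from the
        -- other.
        · have : p.2 = q.2 := by
            have hr : Relator.RightUnique fun a b => ∃ e, P a e b :=
              fun _ _ _ ⟨_, h1⟩ ⟨_, h2⟩ => (h.unique h1 h2).2
            rcases Relation.ReflTransGen.total_of_right_unique hr h2 h2' with h4 | h4
            · exact h.eq_of_child h1 h1' h4
            · exact (h.eq_of_child h1' h1 h4).symm
          rw [this] at h1
          exact Prod.ext (h.unique h1 h1').1 this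
      subst hpq
      rw [ih hw.tail hw'.tail]

theorem exists_walks (h : IsParentRel T r P depth) (hx : x ∈ T.vertexSet) :
    (∃ w, T.IsWalk x w r) ∧ ∃ w, T.IsWalk r w x := by
  induction hn : depth x using Nat.strong_induction_on generalizing x with
  | _ n ih =>
    subst hn
    by_cases hxr : x = r
    · subst hxr
      exact ⟨⟨[], hx, rfl⟩, ⟨[], hx, rfl⟩⟩
    · obtain ⟨e, u, hp⟩ := h.exists_parent x hx hxr
      have hl : T.IsLink e x u := h.isLink_iff.2 (.inl hp)
      obtain ⟨⟨w, hw⟩, ⟨w', hw'⟩⟩ := ih _ (h.depth_lt hp) hl.right_mem rfl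
      exact ⟨⟨(e, u) :: w, hl, hw⟩, ⟨w' ++ [(e, x)], hw'.append ⟨hl.symm, hx, rfl⟩⟩⟩

theorem exists_isSimplePath (h : IsParentRel T r P depth) (hx : x ∈ T.vertexSet)
    (hy : y ∈ T.vertexSet) : ∃ w, T.IsSimplePath x w y := by
  obtain ⟨⟨w, hw⟩, -⟩ := h.exists_walks hx
  obtain ⟨-, ⟨w', hw'⟩⟩ := h.exists_walks hy
  exact (hw.append hw').exists_isSimplePath

theorem isTree (h : IsParentRel T r P depth) : T.IsTree where
  connected _ hx _ hy _ := h.exists_isSimplePath hx hy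
  loopless e x hl := by
    rcases h.isLink_iff.1 hl with h' | h' <;> exact (h.depth_lt h').false
  unique_path x hx y hy _ := by
    obtain ⟨w, hw⟩ := h.exists_isSimplePath hx hy
    exact ⟨w, hw, fun _ hw' => h.path_unique hw' hw⟩

/-- The parent of a vertex is the first step of a simple path to the root. -/
theorem parent_iff (h : IsParentRel T r P depth) {u : α} :
    P x e u ↔ x ≠ r ∧ ∃ w, T.IsSimplePath x ((e, u) :: w) r := by
  have key : ∀ {p : β × α} {w}, x ≠ r → T.IsSimplePath x (p :: w) r → P x p.1 p.2 := by
    intro p w hxr hw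
    rcases h.first_step hw with h' | ⟨-, -, hd⟩
    · exact h'.1
    · rcases Relation.ReflTransGen.cases_head hd with rfl | ⟨c, ⟨e', hc⟩, -⟩
      · exact absurd rfl hxr
      · exact absurd hc h.not_root
  constructor
  · intro hp
    have hxr : x ≠ r := by rintro rfl; exact h.not_root hp
    have hl : T.IsLink e x u := h.isLink_iff.2 (.inl hp)
    obtain ⟨w, hw⟩ := h.exists_isSimplePath hl.left_mem h.root_mem
    cases w with
    | nil => exact absurd hw.1.2 hxr
    | cons p w =>
      obtain ⟨h1, h2⟩ := h.unique hp (key hxr hw)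
      exact ⟨hxr, w, by rwa [h1, h2]⟩
  · rintro ⟨hxr, w, hw⟩
    exact key hxr hw

end IsParentRel

/-- In a tree, the first steps of the simple paths to the root form a parent relation. -/
theorem IsTree.isParentRel (hT : T.IsTree) (hr : r ∈ T.vertexSet) :
    ∃ depth : α → ℕ, T.IsParentRel r (fun v e u => v ≠ r ∧ ∃ w, T.IsSimplePath v ((e, u) :: w) r)
      depth := by
  classical
  have hu : ∀ {v w w'}, T.IsSimplePath v w r → T.IsSimplePath v w' r → w = w' := by
    intro v w w' h h'
    by_cases hvr : v = r
    · subst hvr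
      have aux : ∀ {w : List (β × α)}, T.IsSimplePath v w v → w = [] := by
        intro w h
        cases w with
        | nil => rfl
        | cons p w => exact absurd h.1.2.end_mem_support (List.nodup_cons.1 h.2).1
      rw [aux h, aux h']
    · exact (hT.unique_path v h.1.left_mem r hr hvr).unique h h'
  have hne : ∀ {v p w}, T.IsSimplePath v (p :: w) r → v ≠ r := by
    rintro v p w h rfl
    exact (List.nodup_cons.1 h.2).1 h.1.2.end_mem_support
  -- The depth is the length of the simple path to the root; the default 0 is never compared, since
  -- both ends of a parent step have such a path.
  refine ⟨fun v => if h : ∃ w, T.IsSimplePath v w r then h.choose.length else 0, hr, fun h => h.1 rfl,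
    ?_, ?_, ?_, ?_⟩
  · intro v hv hvr
    obtain ⟨w, hw⟩ := hT.connected v hv r hr hvr
    cases w with
    | nil => exact absurd hw.1.2 hvr
    | cons p w => exact ⟨p.1, p.2, hvr, w, hw⟩
  · rintro v e u e' u' ⟨-, w, h⟩ ⟨-, w', h'⟩
    have := hu h h'
    simp only [List.cons.injEq, Prod.mk.injEq] at this
    exact this.1
  · intro e x y
    constructor
    · intro hl
      have hxy : x ≠ y := by rintro rfl; exact hT.loopless _ _ hl
      obtain ⟨w, hw⟩ : ∃ w, T.IsSimplePath x w r := by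
        by_cases hxr : x = r
        · exact ⟨[], ⟨hl.left_mem, hxr⟩, by simp⟩
        · exact hT.connected x hl.left_mem r hr hxr
      -- If the path from `x` to the root meets `y`, the edge followed by its tail from `y` is a
      -- simple path, so `y` is the parent of `x`; otherwise `x` is the parent of `y`.
      by_cases hy : y ∈ x :: w.map Prod.snd
      · obtain ⟨w', hw', h2⟩ := hw.exists_suffix hy
        have := hw'.cons hl (h2 hxy.symm)
        exact .inl ⟨hne this, w', this⟩
      · have := hw.cons hl.symm hy
        exact .inr ⟨hne this, w, this⟩
    · rintro (⟨-, w, h⟩ | ⟨-, w, h⟩)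
      · exact h.1.1
      · exact h.1.1.symm
  · rintro v e u ⟨-, w, h⟩
    have h1 : ∃ w, T.IsSimplePath v w r := ⟨_, h⟩
    have h2 : ∃ w, T.IsSimplePath u w r := ⟨_, h.tail⟩
    rw [dif_pos h1, dif_pos h2, hu h1.choose_spec h, hu h2.choose_spec h.tail]
    simp

end Graph

/-! ### The determinant of a parent map -/

/-- For a map `N` from the non-root elements to all elements, `det (1 - N)` detects whether `N`
leads every element to the root. -/
theorem Matrix.det_one_sub_parent {V : Type*} [Fintype V] [DecidableEq V] (r : V)
    (N : {v // v ≠ r} → V) (M : Matrix {v // v ≠ r} {v // v ≠ r} ℤ)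
    (hM : ∀ v w, M v w = (if v = w then 1 else 0) - (if N v = w then 1 else 0))
    [Decidable (∃ depth : V → ℕ, ∀ v, depth (N v) < depth v)] :
    M.det = if ∃ depth : V → ℕ, ∀ v, depth (N v) < depth v then 1 else 0 := by
  classical
  split_ifs with h
  · obtain ⟨depth, h⟩ := h
    -- Off the diagonal, nonzero entries go from a vertex to one of strictly smaller depth, so the
    -- diagonal blocks are identities.
    have hb : M.BlockTriangular fun v => OrderDual.toDual (depth v) := by
      intro v w hvw
      have hvw : depth v < depth w := hvw
      rw [hM, if_neg (by rintro rfl; exact hvw.false), if_neg, sub_zero]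
      intro hN
      have := h v
      rw [hN] at this
      exact hvw.not_gt this
    rw [hb.det]
    refine Finset.prod_eq_one fun k _ => ?_
    have : M.toSquareBlock (fun v => OrderDual.toDual (depth v)) k = 1 := by
      ext ⟨v, hv⟩ ⟨w, hw⟩
      have hNw : N v ≠ w := by
        intro hN
        have := h v
        rw [hN] at this
        have hvw : depth v = depth w := OrderDual.toDual.injective (hv.trans hw.symm)
        omega
      simp [Matrix.toSquareBlock_def, hM, hNw, Matrix.one_apply]
    rw [this, Matrix.det_one]
  · rw [← Matrix.exists_mulVec_eq_zero_iff]
    let N' : V → V := fun v => if hv : v = r then r else N ⟨v, hv⟩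
    let Reach : V → Prop := fun v => ∃ k, N'^[k] v = r
    have hN'r : N' r = r := dif_pos rfl
    have hN' : ∀ v : {v // v ≠ r}, N' v = N v := fun v => dif_neg v.2
    have hr : Reach r := ⟨0, rfl⟩
    have hR : ∀ v, Reach (N' v) ↔ Reach v := by
      intro v
      constructor
      · rintro ⟨k, hk⟩
        exact ⟨k + 1, hk⟩
      · rintro ⟨_ | k, hk⟩
        · obtain rfl : v = r := hk
          rwa [hN'r]
        · exact ⟨k, hk⟩
    have hex : ∃ v : {v // v ≠ r}, ¬ Reach v := by
      by_contra! hall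
      have hall : ∀ v, Reach v := fun v => by
        by_cases hv : v = r
        · rwa [hv]
        · exact hall ⟨v, hv⟩
      -- The number of steps needed to reach the root would serve as a depth.
      refine h ⟨fun v => Nat.find (hall v), fun v => ?_⟩
      have hpos : Nat.find (hall v) ≠ 0 := fun h0 => v.2 (by simpa [h0] using Nat.find_spec (hall v))
      obtain ⟨k, hk⟩ := Nat.exists_eq_succ_of_ne_zero hpos
      have h1 := Nat.find_spec (hall v)
      rw [hk, Function.iterate_succ_apply, hN'] at h1
      beta_reduce
      rw [hk]
      exact Nat.lt_succ_of_le (Nat.find_min' _ h1)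
    -- The indicator of the elements that never reach the root is invariant under `N` and zero at
    -- `r`, hence in the kernel.
    refine ⟨fun v => if Reach v then 0 else 1, ?_, ?_⟩
    · obtain ⟨v, hv⟩ := hex
      intro h0
      have := congr_fun h0 v
      simp [hv] at this
    · ext v
      have h2 : ∑ w : {v // v ≠ r}, (if N v = w then (1 : ℤ) else 0) * (if Reach w then 0 else 1) =
          if Reach (N v) then 0 else 1 := by
        by_cases hNr : N v = r
        · rw [hNr, if_pos hr]
          exact Finset.sum_eq_zero fun w _ => by rw [if_neg w.2.symm, zero_mul]
        · rw [Finset.sum_eq_single ⟨N v, hNr⟩]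
          · simp
          · intro w _ hw
            rw [if_neg, zero_mul]
            rintro h3
            exact hw (Subtype.ext h3.symm)
          · simp
      simp only [Matrix.mulVec, dotProduct, hM, sub_mul, Finset.sum_sub_distrib, h2, Pi.zero_apply]
      simp only [← hN', hR, ite_mul, one_mul, zero_mul, Finset.sum_ite_eq, Finset.mem_univ, if_true,
        sub_self]

/-! ### Expansion of the reduced Laplacian determinant -/

namespace Graph

variable {α β : Type*} {G : Graph α β}

namespace EdgeDirection

open Classical in
/-- The incidence number of a vertex and a directed edge. -/
noncomputable def incidence (d : G.EdgeDirection) (v : G.vertexSet) (e : G.edgeSet) : ℤ :=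
  (if d.tgt e = v then 1 else 0) - (if d.src e = v then 1 else 0)

open Classical in
/-- The end of `e` other than `v`. -/
noncomputable def otherEnd (d : G.EdgeDirection) (v : G.vertexSet) (e : G.edgeSet) : G.vertexSet :=
  if d.src e = v then d.tgt e else d.src e

-- The two ends of a non-loop edge have opposite incidence numbers ±1, so the chosen direction
-- cancels in the product.
open Classical in
theorem incidence_mul (d : G.EdgeDirection) {v : G.vertexSet} {e : G.edgeSet}
    (h : d.incidence v e ≠ 0) (w : G.vertexSet) :
    d.incidence v e * d.incidence w e =
      (if v = w then 1 else 0) - (if d.otherEnd v e = w then 1 else 0) := by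
  unfold incidence otherEnd at *
  by_cases h1 : d.tgt e = v <;> by_cases h2 : d.src e = v <;> simp_all

theorem isLink_otherEnd (d : G.EdgeDirection) {v : G.vertexSet} {e : G.edgeSet}
    (h : d.incidence v e ≠ 0) : G.IsLink e v (d.otherEnd v e) := by
  unfold incidence otherEnd at *
  have := d.isLink e
  by_cases h1 : d.tgt e = v <;> by_cases h2 : d.src e = v <;> simp_all [isLink_comm]

theorem incidence_ne_zero (d : G.EdgeDirection) {v w : G.vertexSet} {e : G.edgeSet}
    (h : G.IsLink e v w) (hne : v ≠ w) : d.incidence v e ≠ 0 := by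
  unfold incidence
  rcases h.eq_and_eq_or_eq_and_eq (d.isLink e) with ⟨h1, h2⟩ | ⟨h1, h2⟩ <;>
    rw [← Subtype.ext_iff] at h1 h2 <;> subst h1 <;> simp [← h2, hne.symm]

section

variable [Fintype G.vertexSet] [Fintype G.edgeSet]

/-- The Laplacian of `G` without the row and the column of the root. -/
noncomputable def reducedLaplacian (d : G.EdgeDirection) (r : G.vertexSet) :
    Matrix {v // v ≠ r} {v // v ≠ r} ℤ :=
  Matrix.of fun v w => ∑ e, d.incidence v e * d.incidence w e

/-- The maps which assign to every vertex other than the root an edge towards the root. -/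
def parentMaps (d : G.EdgeDirection) (r : G.vertexSet) : Set ({v // v ≠ r} → G.edgeSet) :=
  {f | (∀ v : {v // v ≠ r}, d.incidence v (f v) ≠ 0) ∧
    ∃ depth : G.vertexSet → ℕ, ∀ v : {v // v ≠ r}, depth (d.otherEnd v (f v)) < depth v}

theorem det_reducedLaplacian (d : G.EdgeDirection) (r : G.vertexSet) [DecidableEq G.vertexSet] :
    (d.reducedLaplacian r).det = (d.parentMaps r).ncard := by
  classical
  have h1 : d.reducedLaplacian r =
      fun v : {v // v ≠ r} => ∑ e, fun w : {v // v ≠ r} => d.incidence v e * d.incidence w e := by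
    ext v w
    simp [reducedLaplacian, Finset.sum_apply]
  -- Multilinearity in the rows: one summand for each choice of an edge per non-root vertex.
  have h2 := (Matrix.detRowAlternating (n := {v // v ≠ r}) (R := ℤ)).toMultilinearMap.map_sum
    fun (v : {v // v ≠ r}) (e : G.edgeSet) (w : {v // v ≠ r}) => d.incidence v e * d.incidence w e
  rw [h1]
  refine h2.trans ?_
  rw [Set.ncard_eq_toFinset_card', ← Set.filter_mem_univ_eq_toFinset, Finset.natCast_card_filter]
  refine Finset.sum_congr rfl fun f _ => ?_
  by_cases hf : ∀ v : {v // v ≠ r}, d.incidence v (f v) ≠ 0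
  · refine (Matrix.det_one_sub_parent r (fun v => d.otherEnd v (f v)) _ fun v w => ?_).trans ?_
    · rw [d.incidence_mul (hf v)]
      simp [Subtype.ext_iff]
    · exact if_congr (and_iff_right hf).symm rfl rfl
  · rw [if_neg fun h => hf h.1]
    push Not at hf
    obtain ⟨v, hv⟩ := hf
    exact Matrix.det_eq_zero_of_row_eq_zero v fun w => by simp [hv]

end

/-! ### Parent maps and spanning trees -/

/-- The spanning subgraph made of the edges of a parent map. -/
def parentGraph (d : G.EdgeDirection) {r : G.vertexSet} (f : {v // v ≠ r} → G.edgeSet)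
    (hf : ∀ v : {v // v ≠ r}, d.incidence v (f v) ≠ 0) : Graph α β where
  vertexSet := G.vertexSet
  IsLink e x y := (∃ v : {v // v ≠ r}, (v : α) = x ∧ f v = e ∧ d.otherEnd v (f v) = y) ∨
    ∃ v : {v // v ≠ r}, (v : α) = y ∧ f v = e ∧ d.otherEnd v (f v) = x
  isLink_symm _ _ := ⟨fun _ _ h => h.symm⟩
  eq_or_eq_of_isLink_of_isLink := by
    have key : ∀ {e : β} {x y : α}, (∃ v : {v // v ≠ r}, (v : α) = x ∧ f v = e ∧ d.otherEnd v (f v) = y) ∨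
        (∃ v : {v // v ≠ r}, (v : α) = y ∧ f v = e ∧ d.otherEnd v (f v) = x) → G.IsLink e x y := by
      rintro e x y (⟨v, rfl, rfl, rfl⟩ | ⟨v, rfl, rfl, rfl⟩)
      · exact d.isLink_otherEnd (hf v)
      · exact (d.isLink_otherEnd (hf v)).symm
    exact fun e x y v w h h' => (key h).left_eq_or_eq (key h')
  left_mem_of_isLink := by
    rintro e x y (⟨v, rfl, rfl, rfl⟩ | ⟨v, rfl, rfl, rfl⟩) <;> exact Subtype.prop _

theorem parentGraph_isSpanningSubgraph (d : G.EdgeDirection) {r : G.vertexSet}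
    (f : {v // v ≠ r} → G.edgeSet) (hf : ∀ v : {v // v ≠ r}, d.incidence v (f v) ≠ 0) :
    d.parentGraph f hf ≤s G where
  vertexSet_mono := le_rfl
  isLink_mono := by
    rintro e x y (⟨v, rfl, rfl, rfl⟩ | ⟨v, rfl, rfl, rfl⟩)
    · exact d.isLink_otherEnd (hf v)
    · exact (d.isLink_otherEnd (hf v)).symm
  vertexSet_eq := rfl

theorem isParentRel_parentGraph (d : G.EdgeDirection) {r : G.vertexSet}
    {f : {v // v ≠ r} → G.edgeSet} (hf : f ∈ d.parentMaps r) :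
    ∃ depth, (d.parentGraph f hf.1).IsParentRel r
      (fun x e y => ∃ v : {v // v ≠ r}, (v : α) = x ∧ f v = e ∧ d.otherEnd v (f v) = y) depth := by
  classical
  obtain ⟨depth, hd⟩ := hf.2
  refine ⟨fun x => if h : x ∈ G.vertexSet then depth ⟨x, h⟩ else 0, r.2, ?_, ?_, ?_, .rfl, ?_⟩
  · rintro e u ⟨v, hv, -⟩
    exact v.2 (Subtype.ext hv)
  · intro v hv hvr
    exact ⟨_, _, ⟨⟨v, hv⟩, fun h => hvr (congrArg Subtype.val h)⟩, rfl, rfl, rfl⟩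
  · rintro _ _ _ _ _ ⟨v, rfl, rfl, rfl⟩ ⟨v', h, rfl, rfl⟩
    obtain rfl : v' = v := Subtype.ext (Subtype.ext h)
    exact ⟨rfl, rfl⟩
  · rintro _ _ _ ⟨v, rfl, rfl, rfl⟩
    simpa using hd v

/-- A tree determines its parent relation through its simple paths to the root (`parent_iff`), which
gives injectivity; surjectivity reads the parent map off a given tree. -/
theorem ncard_parentMaps (d : G.EdgeDirection) (r : G.vertexSet) :
    (d.parentMaps r).ncard = G.spanningTrees.ncard := by
  refine Set.ncard_congr (fun f hf => d.parentGraph f hf.1) ?_ ?_ ?_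
  · intro f hf
    obtain ⟨depth, h⟩ := d.isParentRel_parentGraph hf
    exact ⟨d.parentGraph_isSpanningSubgraph f hf.1, h.isTree⟩
  · intro f f' hf hf' heq
    obtain ⟨depth, h⟩ := d.isParentRel_parentGraph hf
    obtain ⟨depth', h'⟩ := d.isParentRel_parentGraph hf'
    rw [← heq] at h'
    ext v
    have := h'.parent_iff.2 (h.parent_iff.1 ⟨v, rfl, rfl, rfl⟩)
    obtain ⟨v', hv, hf, -⟩ := this
    obtain rfl : v' = v := Subtype.ext (Subtype.ext hv)
    exact hf.symm
  · rintro T ⟨hTG, hT⟩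
    have hr : (r : α) ∈ T.vertexSet := hTG.vertexSet_eq.symm ▸ r.2
    obtain ⟨depth, h⟩ := hT.isParentRel hr
    generalize (fun v e u => v ≠ (r : α) ∧ ∃ w, T.IsSimplePath v ((e, u) :: w) r) = P at h
    have hex : ∀ v : {v // v ≠ r}, ∃ e : G.edgeSet, ∃ u : G.vertexSet, P v e u := by
      intro v
      obtain ⟨e, u, hp⟩ := h.exists_parent v (hTG.vertexSet_eq.symm ▸ v.1.2) (Subtype.coe_ne_coe.2 v.2)
      have hl := (h.isLink_iff.2 (.inl hp)).mono hTG.le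
      exact ⟨⟨e, hl.edge_mem⟩, ⟨u, hl.right_mem⟩, hp⟩
    choose f n hfn using hex
    have hl : ∀ v : {v // v ≠ r}, G.IsLink (f v) v (n v) := fun v => (h.isLink_iff.2 (.inl (hfn v))).mono hTG.le
    have hne : ∀ v : {v // v ≠ r}, (v : G.vertexSet) ≠ n v := by
      intro v hv
      have := h.depth_lt (hfn v)
      rw [← hv] at this
      exact this.false
    have hinc : ∀ v : {v // v ≠ r}, d.incidence v (f v) ≠ 0 := fun v => d.incidence_ne_zero (hl v) (hne v)
    have ho : ∀ v : {v // v ≠ r}, d.otherEnd v (f v) = n v := fun v =>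
      Subtype.ext ((d.isLink_otherEnd (hinc v)).right_unique (hl v))
    refine ⟨f, ⟨hinc, fun v => depth v, fun v => ?_⟩, ?_⟩
    · rw [ho]
      exact h.depth_lt (hfn v)
    · have hP : ∀ {x : α} {e : β} {y : α}, (∃ v : {v // v ≠ r}, (v : α) = x ∧ f v = e ∧ d.otherEnd v (f v) = y) ↔ P x e y := by
        intro x e y
        constructor
        · rintro ⟨v, rfl, rfl, rfl⟩
          rw [ho]
          exact hfn v
        · intro hp
          have hx := ((h.isLink_iff.2 (.inl hp)).mono hTG.le).left_mem
          let v : {v // v ≠ r} := ⟨⟨x, hx⟩, fun hxr => h.not_root (e := e) (u := y) (by rwa [← hxr])⟩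
          obtain ⟨h1, h2⟩ := h.unique (hfn v) hp
          exact ⟨v, rfl, h1, by rw [ho, h2]⟩
      refine Graph.ext hTG.vertexSet_eq.symm fun e x y => ?_
      rw [h.isLink_iff, ← hP, ← hP]
      rfl

end EdgeDirection

end Graph

/-! ### Sublattices of finite index -/

/-- The quotient of a lattice by the range of a matrix with non-zero determinant. -/
theorem Matrix.natCard_quotient_range {n : Type*} [Fintype n] [DecidableEq n] (M : Matrix n n ℤ)
    (hM : M.det ≠ 0) :
    Nat.card ((n → ℤ) ⧸ LinearMap.range M.toLin') = M.det.natAbs := by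
  have hinj : Function.Injective M.toLin' := by
    rw [← LinearMap.ker_eq_bot, LinearMap.ker_eq_bot']
    intro u hu
    by_contra hne
    exact hM (Matrix.exists_mulVec_eq_zero_iff.1 ⟨u, hne, by rwa [Matrix.toLin'_apply] at hu⟩)
  rw [← Submodule.natAbs_det_equiv _ (LinearEquiv.ofInjective M.toLin' hinj), ← LinearMap.det_toLin']
  congr 2

/-- A subgroup of finite index spans rationally. -/
theorem Submodule.bijective_baseChange_subtype {M : Type*} [AddCommGroup M] (N : Submodule ℤ M)
    [Finite (M ⧸ N)] : Function.Bijective (N.subtype.baseChange ℚ) := by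
  constructor
  · exact Module.Flat.lTensor_preserves_injective_linearMap (M := ℚ) _ N.injective_subtype
  · intro t
    induction t using TensorProduct.induction_on with
    | zero => exact ⟨0, map_zero _⟩
    | add a b ha hb =>
      obtain ⟨a', rfl⟩ := ha
      obtain ⟨b', rfl⟩ := hb
      exact ⟨a' + b', map_add _ _ _⟩
    | tmul q c =>
      set k := Nat.card (M ⧸ N) with hk
      have hk0 : (k : ℚ) ≠ 0 := Nat.cast_ne_zero.2 Nat.card_pos.ne'
      have hkc : (k : ℤ) • c ∈ N := by
        rw [← Submodule.Quotient.mk_eq_zero, Submodule.Quotient.mk_smul, Nat.cast_smul_eq_nsmul]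
        exact card_nsmul_eq_zero'
      -- The order k kills the quotient, and q ⊗ c = (q/k) ⊗ kc.
      refine ⟨(q / k) ⊗ₜ ⟨_, hkc⟩, ?_⟩
      rw [LinearMap.baseChange_tmul, Submodule.subtype_apply, TensorProduct.tmul_smul,
        TensorProduct.smul_tmul']
      congr 1
      simp [mul_div_cancel₀, hk0]

/-! ### Cycles, coboundaries and the cokernel -/

namespace Graph

variable {α β : Type*} {G : Graph α β}

namespace EdgeDirection

variable (d : G.EdgeDirection)

theorem boundary_apply [Fintype G.edgeSet] (c : G.C1) (v : G.vertexSet) :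
    d.boundary c v = ∑ e, c e * d.incidence v e := by
  classical
  rw [boundary, Finsupp.linearCombination_apply, Finsupp.sum_fintype _ _ (by simp),
    Finsupp.finsetSum_apply]
  simp [incidence, Finsupp.single_apply]

theorem mem_PiB1 [Finite G.edgeSet] {c : G.C1} :
    c ∈ d.PiB1 ↔ ∃ h : G.vertexSet → ℤ, ∀ e, c e = h (d.tgt e) - h (d.src e) := by
  have hPi : ∀ (F : Module.Dual ℤ G.C1) (e : G.edgeSet), G.Pi F e = F (Finsupp.single e 1) := by
    intro F e
    simp [Pi]
  constructor
  · rintro ⟨_, ⟨F, rfl⟩, rfl⟩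
    refine ⟨fun v => F (Finsupp.single v 1), fun e => ?_⟩
    refine (hPi _ _).trans ?_
    simp [coboundary, boundary]
  · rintro ⟨h, hc⟩
    refine ⟨_, ⟨Finsupp.linearCombination ℤ h, rfl⟩, ?_⟩
    ext e
    refine (hPi _ _).trans ?_
    simp [coboundary, boundary, hc]

theorem sum_mul_incidence [Fintype G.vertexSet] (h : G.vertexSet → ℤ) (e : G.edgeSet) :
    ∑ v, h v * d.incidence v e = h (d.tgt e) - h (d.src e) := by
  simp [incidence, mul_sub, Finset.sum_sub_distrib]

/-- Boundary and coboundary are adjoint: if c is the coboundary of h, then ⟨c, c⟩ = ⟨h, ∂c⟩, which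
vanishes when c is a cycle. -/
theorem disjoint_Z1_PiB1 [Finite G.vertexSet] [Finite G.edgeSet] : Disjoint d.Z1 d.PiB1 := by
  have := Fintype.ofFinite G.vertexSet
  have := Fintype.ofFinite G.edgeSet
  rw [Submodule.disjoint_def]
  intro c hz hb
  obtain ⟨h, hc⟩ := d.mem_PiB1.1 hb
  have hz : d.boundary c = 0 := hz
  have h0 : ∑ e, c e * c e = 0 := by
    calc ∑ e, c e * c e = ∑ e, c e * ∑ v, h v * d.incidence v e := by
          simp only [sum_mul_incidence, ← hc]
      _ = ∑ v, h v * d.boundary c v := by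
          simp only [boundary_apply, Finset.mul_sum]
          rw [Finset.sum_comm]
          exact Finset.sum_congr rfl fun _ _ => Finset.sum_congr rfl fun _ _ => by ring
      _ = 0 := by simp [hz]
  ext e
  exact mul_self_eq_zero.1
    ((Finset.sum_eq_zero_iff_of_nonneg fun e _ => mul_self_nonneg (c e)).1 h0 e (Finset.mem_univ e))

theorem exists_boundary_eq_of_isLink {e : G.edgeSet} {x y : G.vertexSet} (hl : G.IsLink e x y) :
    ∃ c, d.boundary c = Finsupp.single y 1 - Finsupp.single x 1 := by
  rcases (d.isLink e).eq_and_eq_or_eq_and_eq hl with ⟨h1, h2⟩ | ⟨h1, h2⟩ <;>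
    rw [← Subtype.ext_iff] at h1 h2
  · exact ⟨Finsupp.single e 1, by simp [boundary, h1, h2]⟩
  · exact ⟨-Finsupp.single e 1, by simp [boundary, h1, h2]⟩

theorem exists_boundary_eq_of_isWalk {x y : G.vertexSet} {w : List (β × α)} (hw : G.IsWalk x w y) :
    ∃ c, d.boundary c = Finsupp.single y 1 - Finsupp.single x 1 := by
  induction w generalizing x with
  | nil =>
    obtain rfl : x = y := Subtype.ext hw.2
    exact ⟨0, by simp⟩
  | cons p w ih =>
    obtain ⟨c, hc⟩ := ih (x := ⟨p.2, hw.1.right_mem⟩) hw.2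
    obtain ⟨c', hc'⟩ := d.exists_boundary_eq_of_isLink (e := ⟨p.1, hw.1.edge_mem⟩)
      (y := ⟨p.2, hw.1.right_mem⟩) hw.1
    exact ⟨c + c', by rw [map_add, hc, hc']; abel⟩

theorem exists_boundary_eq (hG : G.IsConnected) (x y : G.vertexSet) :
    ∃ c, d.boundary c = Finsupp.single y 1 - Finsupp.single x 1 := by
  by_cases hxy : x = y
  · exact ⟨0, by simp [hxy]⟩
  · obtain ⟨w, hw⟩ := hG x x.2 y y.2 (Subtype.coe_ne_coe.2 hxy)
    exact d.exists_boundary_eq_of_isWalk hw.1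

/-- The boundary map followed by forgetting the coefficient of the root. -/
noncomputable def reducedBoundary (r : G.vertexSet) : G.C1 →ₗ[ℤ] {v // v ≠ r} → ℤ :=
  LinearMap.pi fun v => Finsupp.lapply v.1 ∘ₗ d.boundary

@[simp]
theorem reducedBoundary_apply (r : G.vertexSet) (c : G.C1) (v : {v // v ≠ r}) :
    d.reducedBoundary r c v = d.boundary c v := rfl

/-- The coefficients of a boundary sum to zero, so the one at the root is determined by the others.
-/
theorem ker_reducedBoundary [Finite G.vertexSet] (r : G.vertexSet) :
    LinearMap.ker (d.reducedBoundary r) = d.Z1 := by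
  have := Fintype.ofFinite G.vertexSet
  have hsum : Finsupp.linearCombination ℤ (fun _ : G.vertexSet => (1 : ℤ)) ∘ₗ d.boundary = 0 := by
    ext e
    simp [boundary]
  ext c
  have hc := LinearMap.congr_fun hsum c
  rw [LinearMap.comp_apply, Finsupp.linearCombination_apply, Finsupp.sum_fintype _ _ (by simp)] at hc
  rw [Z1, LinearMap.mem_ker, LinearMap.mem_ker]
  constructor
  · intro h
    have h' : ∀ v, v ≠ r → d.boundary c v = 0 := fun v hv => congr_fun h ⟨v, hv⟩
    rw [Finset.sum_eq_single r (fun v _ hv => by simp [h' v hv]) (by simp)] at hc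
    ext v
    by_cases hv : v = r
    · subst hv
      simpa using hc
    · exact h' v hv
  · intro h
    ext v
    simp [h]

/-- A chain with boundary v - r maps to the basis vector of v. -/
theorem reducedBoundary_surjective [Finite G.vertexSet] (hG : G.IsConnected) (r : G.vertexSet) :
    Function.Surjective (d.reducedBoundary r) := by
  classical
  have := Fintype.ofFinite G.vertexSet
  choose c hc using fun v => d.exists_boundary_eq hG r v
  intro u
  refine ⟨∑ v : {v // v ≠ r}, u v • c v, ?_⟩
  ext w
  have h : ∀ v : {v // v ≠ r}, d.reducedBoundary r (c v) w = if v = w then 1 else 0 := by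
    intro v
    simp [hc, Finsupp.single_apply, w.2.symm, Subtype.ext_iff]
  rw [map_sum, Finset.sum_apply]
  simp [h, -reducedBoundary_apply]

section

variable [Fintype G.vertexSet] [Fintype G.edgeSet] [DecidableEq G.vertexSet]

theorem reducedLaplacian_mulVec (r : G.vertexSet) {h : G.vertexSet → ℤ} (hr : h r = 0) {c : G.C1}
    (hc : ∀ e, c e = h (d.tgt e) - h (d.src e)) :
    (d.reducedLaplacian r).toLin' (fun v => h v) = d.reducedBoundary r c := by
  have hsub : ∀ g : G.vertexSet → ℤ, g r = 0 → ∑ v : {v // v ≠ r}, g v = ∑ v, g v := by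
    intro g hg
    rw [← Finset.sum_erase Finset.univ hg]
    exact (Finset.sum_subtype _ (by simp) g).symm
  ext v
  rw [Matrix.toLin'_apply, reducedBoundary_apply, boundary_apply]
  simp only [Matrix.mulVec, dotProduct, reducedLaplacian, Matrix.of_apply, hc, ← sum_mul_incidence,
    Finset.sum_mul]
  rw [Finset.sum_comm]
  refine Finset.sum_congr rfl fun e _ => ?_
  -- As `h` vanishes at the root, the sum over all vertices loses nothing when restricted to the
  -- others.
  rw [← hsub _ (by simp [hr])]
  exact Finset.sum_congr rfl fun _ _ => by ring

theorem map_PiB1 (r : G.vertexSet) :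
    d.PiB1.map (d.reducedBoundary r) = LinearMap.range (d.reducedLaplacian r).toLin' := by
  ext u
  constructor
  · rintro ⟨c, hc, rfl⟩
    obtain ⟨h, hc⟩ := d.mem_PiB1.1 hc
    -- A potential matters only up to a constant, so it can be made zero at the root.
    exact ⟨_, d.reducedLaplacian_mulVec r (h := fun v => h v - h r) (sub_self _)
      fun e => by rw [hc]; ring⟩
  · rintro ⟨u, rfl⟩
    let h : G.vertexSet → ℤ := fun v => if hv : v = r then 0 else u ⟨v, hv⟩
    let c : G.C1 := Finsupp.equivFunOnFinite.symm fun e => h (d.tgt e) - h (d.src e)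
    refine ⟨c, d.mem_PiB1.2 ⟨h, fun _ => rfl⟩, ?_⟩
    rw [← d.reducedLaplacian_mulVec r (h := h) (dif_pos rfl) fun _ => rfl]
    congr 1
    ext v
    exact dif_neg v.2

/-- A kernel vector, extended by 0 at the root, has a coboundary that is also a cycle, hence zero;
by connectedness the potential is constant, so zero. -/
theorem det_reducedLaplacian_ne_zero (hG : G.IsConnected) (r : G.vertexSet) :
    (d.reducedLaplacian r).det ≠ 0 := by
  rw [Ne, ← Matrix.exists_mulVec_eq_zero_iff]
  rintro ⟨u, hu, h0⟩
  let h : G.vertexSet → ℤ := fun v => if hv : v = r then 0 else u ⟨v, hv⟩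
  have hu' : u = fun v : {v // v ≠ r} => h v := by
    ext v
    simp [h, v.2]
  let c : G.C1 := Finsupp.equivFunOnFinite.symm fun e => h (d.tgt e) - h (d.src e)
  have hc0 : c = 0 := by
    refine Submodule.disjoint_def.1 d.disjoint_Z1_PiB1 c ?_ (d.mem_PiB1.2 ⟨h, fun _ => rfl⟩)
    rw [← d.ker_reducedBoundary r, LinearMap.mem_ker,
      ← d.reducedLaplacian_mulVec r (h := h) (dif_pos rfl) fun _ => rfl, ← hu', Matrix.toLin'_apply, h0]
  have hcomp : Finsupp.linearCombination ℤ h ∘ₗ d.boundary = 0 := by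
    ext e
    have := DFunLike.congr_fun hc0 e
    simpa [boundary, c] using this
  refine hu (funext fun v => ?_)
  obtain ⟨b, hb⟩ := d.exists_boundary_eq hG r v
  have := LinearMap.congr_fun hcomp b
  have hr : h r = 0 := dif_pos rfl
  rw [LinearMap.comp_apply, hb] at this
  rw [hu']
  simpa [hr] using this

end

/-- The quotient is the cokernel of the reduced Laplacian. -/
theorem natCard_quotient [Finite G.vertexSet] [Finite G.edgeSet] (hG : G.IsConnected)
    (r : G.vertexSet) :
    Nat.card (G.C1 ⧸ (d.Z1 ⊔ d.PiB1)) = G.spanningTrees.ncard ∧ G.spanningTrees.ncard ≠ 0 := by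
  classical
  have := Fintype.ofFinite G.vertexSet
  have := Fintype.ofFinite G.edgeSet
  let S := LinearMap.range (d.reducedLaplacian r).toLin'
  have hker : LinearMap.ker (S.mkQ ∘ₗ d.reducedBoundary r) = d.Z1 ⊔ d.PiB1 := by
    rw [LinearMap.ker_comp, Submodule.ker_mkQ, show S = _ from (d.map_PiB1 r).symm, Submodule.comap_map_eq,
      d.ker_reducedBoundary, sup_comm]
  have e : (G.C1 ⧸ (d.Z1 ⊔ d.PiB1)) ≃ₗ[ℤ] ({v // v ≠ r} → ℤ) ⧸ S :=
    (Submodule.quotEquivOfEq _ _ hker.symm).trans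
      ((S.mkQ ∘ₗ d.reducedBoundary r).quotKerEquivOfSurjective
        (S.mkQ_surjective.comp (d.reducedBoundary_surjective hG r)))
  have hdet := d.det_reducedLaplacian_ne_zero hG r
  have hcard := Matrix.natCard_quotient_range _ hdet
  rw [d.det_reducedLaplacian r, d.ncard_parentMaps r] at hdet hcard
  exact ⟨(Nat.card_congr e.toEquiv).trans hcard, by exact_mod_cast hdet⟩

end EdgeDirection

theorem spanningTrees_ncard_of_isEmpty [IsEmpty G.vertexSet] : G.spanningTrees.ncard = 1 := by
  have hV : ∀ x, x ∉ G.vertexSet := fun x hx => isEmptyElim (⟨x, hx⟩ : G.vertexSet)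
  rw [Set.ncard_eq_one]
  refine ⟨G, Set.eq_singleton_iff_unique_mem.2 ⟨⟨IsSpanningSubgraph.rfl, ?_⟩, ?_⟩⟩
  · exact ⟨fun x hx => absurd hx (hV x), fun e x h => hV x h.left_mem,
      fun x hx => absurd hx (hV x)⟩
  · rintro T ⟨hT, -⟩
    exact Graph.ext hT.vertexSet_eq fun e x y =>
      ⟨fun h => h.mono hT.le, fun h => absurd h.left_mem (hV x)⟩

end Graph

/-- `Z₁(G;ℤ)` and `Π(B¹(G;ℤ))` are in direct sum in `C₁(G;ℤ)`, the inclusion of this sum is a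
rational equivalence (an isomorphism after tensoring with `ℚ`), and the quotient is a finite group
whose order is the number of spanning trees of `G`. -/
theorem theorem6p1 {α β : Type*} (G : Graph α β) [Finite G.vertexSet] [Finite G.edgeSet]
    (hG : G.IsConnected) (d : G.EdgeDirection) :
    Disjoint d.Z1 d.PiB1 ∧
      Function.Bijective ((d.Z1 ⊔ d.PiB1).subtype.baseChange ℚ) ∧
      Finite (G.C1 ⧸ (d.Z1 ⊔ d.PiB1)) ∧
      Nat.card (G.C1 ⧸ (d.Z1 ⊔ d.PiB1)) = G.spanningTrees.ncard := by
  have hcard : Nat.card (G.C1 ⧸ (d.Z1 ⊔ d.PiB1)) = G.spanningTrees.ncard ∧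
      G.spanningTrees.ncard ≠ 0 := by
    -- The empty graph counts as connected but offers no root; both sides are then 1.
    rcases isEmpty_or_nonempty G.vertexSet with hV | ⟨⟨r⟩⟩
    · have : IsEmpty G.edgeSet := ⟨fun e => isEmptyElim (d.src e)⟩
      rw [Graph.spanningTrees_ncard_of_isEmpty]
      exact ⟨Nat.card_unique, one_ne_zero⟩
    · exact d.natCard_quotient hG r
  have hfin : Finite (G.C1 ⧸ (d.Z1 ⊔ d.PiB1)) :=
    Nat.finite_of_card_ne_zero (hcard.1 ▸ hcard.2)
  exact ⟨d.disjoint_Z1_PiB1, Submodule.bijective_baseChange_subtype _, hfin, hcard.1⟩
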